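/- Let the target $X^*$ be a random vector in $\mathbb R^d$, $d\ge 1$, whose law $\mu$ has a Lebesgue density $p_0$ with finite differential entropy $H(p_0)=-\int p_0\log p_0$. One asks $n$ queries "is $X^*\in A_t$?", $t=1,\dots,n$. The response to each query is correct except with probability $\epsilon\in[0,\tfrac12)$, the same for all queries, and the errors are independent of each other, of $X^*$, and of the sequence of independent fair coins available to the policy. Let $C(\epsilon)$ be the capacity, in nats, of the binary symmetric channel with error probability $\epsilon$ (the maximum of the mutual information over the input distributions). A joint query policy $\pi_J$ chooses each $A_t\subseteq\mathbb R^d$ as an arbitrary measurable set depending on the history (past responses and coins) and on a fresh coin; it maintains the Bayesian joint posterior, and $X_n$ is a coordinatewise median of this posterior after $n$ queries. An independent query policy $\pi_I$ maintains one distribution for each coordinate, starting from the marginal of $\mu$; query number $t$ concerns a prescribed coordinate $i_t$, whose current distribution is bisected at a median $m$; one of the regions $\{x: x_{i_t}\le m\}$, $\{x: x_{i_t}>m\}$ is selected by a fair coin and queried, and the distribution of coordinate $i_t$ alone is updated by Bayes' rule. Here $X_n$ consists of medians of the $d$ coordinate distributions after $n$ queries. The allocation is equal if the numbers of queries (among the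 first $n$) to any two coordinates differ by at most one. Then for every $\eta\in\mathbb R$ there is a constant $K>0$, depending only on $\eta$, such that for all $d\ge1$, all such laws with $H(p_0)/d\ge\eta$, all $\epsilon\in[0,\frac12)$ and all $n\ge 0$, every independent query policy $\pi_I$ with equal allocation of the $n$ queries, and every joint query policy $\pi_J$, satisfy the same lower bound $$K\,d\,e^{-2nC(\epsilon)/d}\;\le\;\mathbb E\big[\|X_n-X^*\|_2^2\big],$$ where the right-hand side may be infinite. -/

import Mathlib

open MeasureTheory ProbabilityTheory

noncomputable section

namespace TargetSearch

/-! ### The binary symmetric channel -/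

/-- Transition probability of the binary symmetric channel with error probability `ε`:
the probability of receiving `y` when `z` is sent. -/
def bsc (ε : ℝ) (z y : Bool) : ℝ := if y = z then 1 - ε else ε

/-- The input distribution on `{0, 1}` that gives mass `p` to `1`. -/
def inputLaw (p : ℝ) (z : Bool) : ℝ := if z then p else 1 - p

/-- Mutual information (in nats) between input and output of the binary symmetric channel
when the input is `1` with probability `p`. -/
def bscMutualInfo (ε p : ℝ) : ℝ :=
  ∑ z : Bool, ∑ y : Bool, inputLaw p z * bsc ε z y *
    Real.log (bsc ε z y / ∑ z' : Bool, inputLaw p z' * bsc ε z' y)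

/-- Capacity (in nats) of the binary symmetric channel: the largest mutual information over
all input distributions. -/
def bscCapacity (ε : ℝ) : ℝ := sSup (bscMutualInfo ε '' Set.Icc 0 1)

/-! ### Prior and posterior distributions -/

/-- The target space. -/
abbrev Space (d : ℕ) : Type := EuclideanSpace ℝ (Fin d)

/-- The density of `μ` with respect to Lebesgue measure. -/
def density {d : ℕ} (μ : Measure (Space d)) (x : Space d) : ℝ := (μ.rnDeriv volume x).toReal

/-- The differential entropy `-∫ p log p` (in nats) of a distribution with density `p`. -/
def differentialEntropy {d : ℕ} (μ : Measure (Space d)) : ℝ :=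
  ∫ x, Real.negMulLog (density μ x)

/-- `μ` is a probability distribution with a Lebesgue density and finite differential entropy. -/
structure IsPrior {d : ℕ} (μ : Measure (Space d)) : Prop where
  prob : IsProbabilityMeasure μ
  ac : μ ≪ volume
  finite_entropy : Integrable (fun x => Real.negMulLog (density μ x))

open Classical in
/-- The likelihood of the response `y` to the query "is the target in `A`?" if the target
is at `x`. -/
def likelihood {E : Type*} (ε : ℝ) (A : Set E) (y : Bool) (x : E) : ENNReal :=
  ENNReal.ofReal (bsc ε (decide (x ∈ A)) y)

/-- Bayes' rule: the belief `ν` after the response `y` to the query `A`. If `ν A = 1 / 2`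
the normalising factor is `2`. (A response of probability zero gives the zero measure.) -/
def bayesUpdate {E : Type*} [MeasurableSpace E] (ε : ℝ) (A : Set E) (y : Bool)
    (ν : Measure E) : Measure E :=
  (ν.withDensity (likelihood ε A y) Set.univ)⁻¹ • ν.withDensity (likelihood ε A y)

/-- `m` is a median of the finite measure `ν` on the line: at most half of the mass lies on
either side. -/
def IsMedian (ν : Measure ℝ) (m : ℝ) : Prop :=
  ν (Set.Iio m) ≤ ν Set.univ / 2 ∧ ν (Set.Ioi m) ≤ ν Set.univ / 2

/-- The marginal distribution of the `i`-th coordinate. -/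
def marginal {d : ℕ} (μ : Measure (Space d)) (i : Fin d) : Measure ℝ :=
  μ.map (fun x => x i)

/-! ### Query policies -/

/-- A history of past queries, most recent first: for each query the value of the fair coin
the policy could use to form the query region, and the response. -/
abbrev History : Type := List (Bool × Bool)

/-- A rule that gives the next query region from the history and a fresh fair coin. -/
abbrev QueryRule (d : ℕ) : Type := History → Bool → Set (Space d)

/-- A joint query policy: at each step an arbitrary measurable region of the whole target
space is queried, depending on the history (and possibly on a coin). -/
structure JointPolicy (d : ℕ) where
  region : QueryRule d
  measurableSet_region : ∀ h c, MeasurableSet (region h c)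

/-- The joint posterior distribution after the history `h`. -/
def jointPosterior {d : ℕ} (μ : Measure (Space d)) (ε : ℝ) (region : QueryRule d) :
    History → Measure (Space d)
  | [] => μ
  | (c, y) :: h => bayesUpdate ε (region h c) y (jointPosterior μ ε region h)

/-- The two half-lines cut off by the query point `m`; the coin `c` selects one of them. -/
def halfLine (m : ℝ) (c : Bool) : Set ℝ := if c then Set.Iic m else Set.Ioi m

/-- The belief on the `i`-th coordinate after the history `h`, when query number `t` is about
the coordinate `axis t` and the query point after the history `h` is `point h`. It starts from
the marginal of the prior and is updated only by the responses to queries about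
coordinate `i`. -/
def coordPosterior {d : ℕ} (μ : Measure (Space d)) (ε : ℝ) (axis : ℕ → Fin d)
    (point : History → ℝ) (i : Fin d) : History → Measure ℝ
  | [] => marginal μ i
  | (c, y) :: h =>
      if axis h.length = i then
        bayesUpdate ε (halfLine (point h) c) y (coordPosterior μ ε axis point i h)
      else coordPosterior μ ε axis point i h

/-- An independent (per-dimension) query policy: one distribution is kept for each coordinate;
query number `t` concerns the coordinate `axis t`, whose current distribution is bisected at
a median, and one of the two resulting regions, chosen by the coin, is queried. -/
structure IndependentPolicy {d : ℕ} (μ : Measure (Space d)) (ε : ℝ) where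
  axis : ℕ → Fin d
  point : History → ℝ
  isMedian_point : ∀ h : History,
    IsMedian (coordPosterior μ ε axis point (axis h.length) h) (point h)

namespace IndependentPolicy

variable {d : ℕ} {μ : Measure (Space d)} {ε : ℝ}

/-- The query regions: slabs of the target space cut off orthogonally to one axis. -/
def region (π : IndependentPolicy μ ε) : QueryRule d :=
  fun h c => {x | x (π.axis h.length) ∈ halfLine (π.point h) c}

/-- The number of the first `n` queries that are about coordinate `i`. -/
def queryCount (π : IndependentPolicy μ ε) (n : ℕ) (i : Fin d) : ℕ :=
  ((Finset.range n).filter (fun t => π.axis t = i)).card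

/-- Equal allocation of `n` queries: the numbers of queries per coordinate differ by at most
one (so they all equal `n / d` if `d` divides `n`). -/
def EqualAllocation (π : IndependentPolicy μ ε) (n : ℕ) : Prop :=
  ∀ i j : Fin d, π.queryCount n i ≤ π.queryCount n j + 1

/-- `est` assigns to each history a median of the belief on each coordinate. -/
def IsMedianEstimate (π : IndependentPolicy μ ε) (est : History → Space d) : Prop :=
  ∀ (h : History) (i : Fin d), IsMedian (coordPosterior μ ε π.axis π.point i h) (est h i)

end IndependentPolicy

/-- `est` assigns to each history a coordinatewise median of the joint posterior. -/
def JointPolicy.IsMedianEstimate {d : ℕ} (π : JointPolicy d) (μ : Measure (Space d)) (ε : ℝ)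
    (est : History → Space d) : Prop :=
  ∀ (h : History) (i : Fin d),
    IsMedian (marginal (jointPosterior μ ε π.region h) i) (est h i)

/-! ### The search process -/

/-- The random elements of the search: the target `X` with law `μ`, the indicators `N t` of an
erroneous response to query number `t`, which have probability `ε`, and fair coins `W t`,
all mutually independent. -/
structure IsSearchModel {d : ℕ} (μ : Measure (Space d)) (ε : ℝ) {Ω : Type*}
    [MeasurableSpace Ω] (P : Measure Ω) (X : Ω → Space d) (N W : ℕ → Ω → Bool) : Prop where
  measurable_target : Measurable X
  measurable_noise : ∀ t, Measurable (N t)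
  measurable_coin : ∀ t, Measurable (W t)
  law_target : P.map X = μ
  law_noise : ∀ t, P {ω | N t ω = true} = ENNReal.ofReal ε
  law_coin : ∀ t, P {ω | W t ω = true} = 1 / 2
  indep_bits : iIndepFun (Sum.elim N W) P
  indep_target : IndepFun X (fun ω (s : ℕ ⊕ ℕ) => Sum.elim N W s ω) P

open Classical in
/-- The history after `n` queries. The response to a query is the truth value of "the target is
in the region", flipped if an error occurs. -/
def history {d : ℕ} {Ω : Type*} (region : QueryRule d) (X : Ω → Space d)
    (N W : ℕ → Ω → Bool) : ℕ → Ω → History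
  | 0, _ => []
  | t + 1, ω =>
      let h := history region X N W t ω
      (W t ω, xor (decide (X ω ∈ region h (W t ω))) (N t ω)) :: h

/-- The mean squared error `E ‖Y - X‖²` (possibly infinite). -/
def meanSquaredError {d : ℕ} {Ω : Type*} [MeasurableSpace Ω] (P : Measure Ω)
    (Y X : Ω → Space d) : ENNReal :=
  ∫⁻ ω, ENNReal.ofReal (‖Y ω - X ω‖ ^ 2) ∂P

end TargetSearch

end

namespace TargetSearch

/-! ### Capacity of the binary symmetric channel -/

/-! The bound is information-theoretic: each response carries at most `bscCapacity ε` nats, so after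
`n` queries the target keeps conditional entropy at least `H - n C`, and among laws of given second
moment about the estimate the Gaussian has the largest entropy. Both policies query measurable sets
determined by the history and a coin, and both estimate by a function of the history, so one bound
covers them.

The argument avoids conditional entropies and needs a single Gibbs inequality. Compare the true law
of (history, target) with the reference law in which coins and responses are uniform and the target,
given the history, is Gaussian with covariance `s` times the identity, centred at the estimate. The
density ratio `R` of reference to true law is the Gaussian density over the prior density, times a
factor `1 / (2 e)` per query, `e` being the probability of the error bit that occurred.
`lintegral_density_ratio_le_one` gives `E R ≤ 1`, by removing the queries one at a time. Then `E log
R ≤ E R - 1 ≤ 0`, expanded term by term, is the entropy balance `differentialEntropy_le`; each query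
contributes `log 2` minus the noise entropy, which is at most the capacity. A suitable `s` yields
the bound. -/

theorem mul_log_div_le_one {a s : ℝ} (ha : 0 ≤ a) {b : ℝ} (hb : 0 ≤ b) (hb1 : b ≤ 1)
    (hs : a * b ≤ s) : a * b * Real.log (b / s) ≤ 1 := by
  have hab : 0 ≤ a * b := mul_nonneg ha hb
  have hs0 : 0 ≤ s := hab.trans hs
  calc a * b * Real.log (b / s) ≤ a * b * (b / s) :=
        mul_le_mul_of_nonneg_left (Real.log_le_self (div_nonneg hb hs0)) hab
    _ = (a * b / s) * b := by ring
    _ ≤ 1 * 1 := mul_le_mul (div_le_one_of_le₀ hs hs0) hb1 hb zero_le_one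
    _ = 1 := one_mul 1

/-- Needed because the real `sSup` bounds its elements only when the set is bounded above. The crude
bound is 1 for each of the four terms. -/
theorem bddAbove_bscMutualInfo {ε : ℝ} (h0 : 0 ≤ ε) (h1 : ε ≤ 1) :
    BddAbove (bscMutualInfo ε '' Set.Icc 0 1) := by
  refine ⟨4, ?_⟩
  rintro _ ⟨p, ⟨hp0, hp1⟩, rfl⟩
  have hq : ∀ z, 0 ≤ inputLaw p z ∧ inputLaw p z ≤ 1 := by
    intro z; cases z <;> simp [inputLaw, hp0, hp1]
  have hb : ∀ z y, 0 ≤ bsc ε z y ∧ bsc ε z y ≤ 1 := by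
    intro z y; unfold bsc; split_ifs <;> constructor <;> linarith
  have hterm : ∀ z y, inputLaw p z * bsc ε z y *
      Real.log (bsc ε z y / ∑ z' : Bool, inputLaw p z' * bsc ε z' y) ≤ 1 := fun z y =>
    mul_log_div_le_one (hq z).1 (hb z y).1 (hb z y).2
      (Finset.single_le_sum (f := fun z' => inputLaw p z' * bsc ε z' y)
        (fun z' _ => mul_nonneg (hq z').1 (hb z' y).1) (Finset.mem_univ z))
  calc bscMutualInfo ε p ≤ ∑ _z : Bool, ∑ _y : Bool, (1 : ℝ) :=
        Finset.sum_le_sum fun z _ => Finset.sum_le_sum fun y _ => hterm z y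
    _ = 4 := by norm_num

/-- Uniform inputs show that the capacity is at least `log 2` minus the entropy of the noise. -/
theorem log_two_sub_noise_entropy_le_bscCapacity {ε : ℝ} (h0 : 0 ≤ ε) (h1 : ε ≤ 1) :
    Real.log 2 + (ε * Real.log ε + (1 - ε) * Real.log (1 - ε)) ≤ bscCapacity ε := by
  have key : ∀ x : ℝ, x * Real.log (x / 2⁻¹) = x * Real.log x + x * Real.log 2 := by
    intro x
    rcases eq_or_ne x 0 with rfl | hx
    · simp
    · rw [div_inv_eq_mul, Real.log_mul hx two_ne_zero]; ring
  have hmi : bscMutualInfo ε 2⁻¹ =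
      Real.log 2 + (ε * Real.log ε + (1 - ε) * Real.log (1 - ε)) := by
    have e1 : (2⁻¹ * (1 - ε) + (1 - 2⁻¹) * ε : ℝ) = 2⁻¹ := by ring
    have e2 : (2⁻¹ * ε + (1 - 2⁻¹) * (1 - ε) : ℝ) = 2⁻¹ := by ring
    simp only [bscMutualInfo, inputLaw, bsc, Fintype.sum_bool]
    simp only [if_true, Bool.false_eq_true, Bool.true_eq_false, if_false, e1, e2]
    linear_combination key ε + key (1 - ε)
  rw [← hmi]
  exact le_csSup (bddAbove_bscMutualInfo h0 h1) ⟨2⁻¹, by norm_num, rfl⟩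

/-! ### Measurability of the history -/

/-- Histories are countably many, so measurability in the history reduces to level sets, under the
discrete σ-algebra. -/
theorem measurable_comp_of_countable {Ω E H : Type*} [Countable H] [MeasurableSpace Ω]
    [MeasurableSpace E] {h : Ω → H} {X : Ω → E} (hh : ∀ k, MeasurableSet {ω | h ω = k})
    (hX : Measurable X) {β : Type*} [MeasurableSpace β] {F : H → E → β}
    (hF : ∀ k, Measurable (F k)) : Measurable fun ω => F (h ω) (X ω) := by
  let _ : MeasurableSpace H := ⊤
  have _ : MeasurableSingletonClass H := ⟨fun _ => trivial⟩
  have hm : Measurable h := measurable_to_countable' hh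
  exact (measurable_from_prod_countable_right (f := fun p : H × E => F p.1 p.2) hF).comp
    (hm.prodMk hX)

theorem measurable_answer {E : Type*} [MeasurableSpace E] {A : Set E} [DecidablePred (· ∈ A)]
    (hA : MeasurableSet A) (a : Bool) : Measurable fun x => xor (decide (x ∈ A)) a := by
  have : (fun x => xor (decide (x ∈ A)) a) = fun x => if x ∈ A then !a else a := by
    ext x; by_cases hx : x ∈ A <;> simp [hx]
  rw [this]
  exact Measurable.ite hA measurable_const measurable_const

/-- Only the first `n` bits are assumed measurable, so this also applies with `past X N W n` as the
σ-algebra on `Ω`. -/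
theorem measurableSet_history_eq {d : ℕ} {Ω : Type*} [MeasurableSpace Ω] {region : QueryRule d}
    (hr : ∀ h c, MeasurableSet (region h c)) {X : Ω → Space d} {N W : ℕ → Ω → Bool} {n : ℕ}
    (hX : Measurable X) (hN : ∀ t < n, Measurable (N t)) (hW : ∀ t < n, Measurable (W t))
    (k : History) : MeasurableSet {ω | history region X N W n ω = k} := by
  classical
  induction n generalizing k with
  | zero => simp [history]
  | succ n ih =>
    have ih' := ih (fun t ht => hN t (ht.trans n.lt_succ_self))
      (fun t ht => hW t (ht.trans n.lt_succ_self))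
    have hbits : Measurable fun ω => (W n ω, N n ω) :=
      (hW n n.lt_succ_self).prodMk (hN n n.lt_succ_self)
    have hstep : ∀ h : History, Measurable fun p : (Bool × Bool) × Space d =>
        (p.1.1, xor (decide (p.2 ∈ region h p.1.1)) p.1.2) := fun h =>
      measurable_from_prod_countable_right
        (f := fun p : (Bool × Bool) × Space d =>
          (p.1.1, xor (decide (p.2 ∈ region h p.1.1)) p.1.2))
        fun b => Measurable.prodMk (f := fun _ => b.1) measurable_const
          (measurable_answer (hr h b.1) b.2)
    have hF : ∀ h : History, Measurable fun p : (Bool × Bool) × Space d =>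
        ((p.1.1, xor (decide (p.2 ∈ region h p.1.1)) p.1.2) :: h = k) := fun h =>
      (Measurable.of_discrete (f := fun b : Bool × Bool => (b :: h = k))).comp (hstep h)
    have := measurable_comp_of_countable ih' (hbits.prodMk hX) hF
    convert! measurableSet_setOfPred.2 this using 1

/-! ### Independence of the next bits from the past -/

/-- The probability of the error indicator taking a given value. -/
noncomputable def errorProb (ε : ℝ) (a : Bool) : ℝ := if a then ε else 1 - ε

/-- The joint law is a product of three laws, which may be reassociated. -/
theorem indepFun_prodMk_of_indepFun {Ω A B C : Type*} [MeasurableSpace Ω] [MeasurableSpace A]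
    [MeasurableSpace B] [MeasurableSpace C] {P : Measure Ω} [IsProbabilityMeasure P]
    {f : Ω → A} {g : Ω → B} {k : Ω → C} (hf : Measurable f) (hg : Measurable g)
    (hk : Measurable k) (h : IndepFun f (fun ω => (g ω, k ω)) P) (hgk : IndepFun g k P) :
    IndepFun (fun ω => (f ω, g ω)) k P := by
  have hfg : IndepFun f g P := h.comp measurable_id measurable_fst
  rw [indepFun_iff_map_prod_eq_prod_map_map (by fun_prop) (by fun_prop)] at h hgk hfg ⊢
  have := Measure.isProbabilityMeasure_map (μ := P) hf.aemeasurable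
  have := Measure.isProbabilityMeasure_map (μ := P) hg.aemeasurable
  have := Measure.isProbabilityMeasure_map (μ := P) hk.aemeasurable
  apply (MeasurableEquiv.prodAssoc (α := A) (β := B) (γ := C)).map_measurableEquiv_injective
  rw [hfg, Measure.prodAssoc_prod, ← hgk, ← h,
    Measure.map_map (MeasurableEquiv.measurable _) (by fun_prop)]
  rfl

namespace IsSearchModel

variable {d : ℕ} {μ : Measure (Space d)} {ε : ℝ} {Ω : Type*} {X : Ω → Space d} {N W : ℕ → Ω → Bool}

/-- The σ-algebra generated by the target and the first `n` errors and coins. -/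
@[reducible] def past (X : Ω → Space d) (N W : ℕ → Ω → Bool) (n : ℕ) : MeasurableSpace Ω :=
  MeasurableSpace.comap (fun ω => (X ω,
    fun s : (Finset.range n).disjSum (Finset.range n) => Sum.elim N W s ω)) inferInstance

theorem measurable_target_past (n : ℕ) : Measurable[past X N W n] X :=
  measurable_fst.comp (comap_measurable _)

theorem measurable_noise_past {n t : ℕ} (ht : t < n) : Measurable[past X N W n] (N t) := by
  have hs : Sum.inl t ∈ (Finset.range n).disjSum (Finset.range n) := by simpa using ht
  have hm : Measurable fun p : Space d × ((Finset.range n).disjSum (Finset.range n) → Bool) =>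
      p.2 ⟨Sum.inl t, hs⟩ := (measurable_pi_apply _).comp measurable_snd
  exact hm.comp (comap_measurable _)

theorem measurable_coin_past {n t : ℕ} (ht : t < n) : Measurable[past X N W n] (W t) := by
  have hs : Sum.inr t ∈ (Finset.range n).disjSum (Finset.range n) := by simpa using ht
  have hm : Measurable fun p : Space d × ((Finset.range n).disjSum (Finset.range n) → Bool) =>
      p.2 ⟨Sum.inr t, hs⟩ := (measurable_pi_apply _).comp measurable_snd
  exact hm.comp (comap_measurable _)

variable [MeasurableSpace Ω] {P : Measure Ω}

theorem measurable_bits (hM : IsSearchModel μ ε P X N W) (s : ℕ ⊕ ℕ) :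
    Measurable (Sum.elim N W s) := by
  cases s with
  | inl t => exact hM.measurable_noise t
  | inr t => exact hM.measurable_coin t

theorem past_le (hM : IsSearchModel μ ε P X N W) (n : ℕ) : past X N W n ≤ ‹MeasurableSpace Ω› :=
  Measurable.comap_le <| hM.measurable_target.prodMk <| measurable_pi_lambda
    (fun ω (s : (Finset.range n).disjSum (Finset.range n)) => Sum.elim N W s ω)
    fun s => hM.measurable_bits s

variable [IsProbabilityMeasure P]

/-- Bits with disjoint index sets are independent, and the target is independent of all bits
jointly; reassociation moves the target to the side of the old bits. -/
theorem indep_past_bits (hM : IsSearchModel μ ε P X N W) (n : ℕ) :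
    Indep (past X N W n) (MeasurableSpace.comap (fun ω => (W n ω, N n ω)) inferInstance) P := by
  have hST : Disjoint ((Finset.range n).disjSum (Finset.range n))
      ((({n} : Finset ℕ).disjSum {n}) : Finset (ℕ ⊕ ℕ)) := by
    rw [Finset.disjoint_left]
    rintro (t | t) <;> simp <;> omega
  have h1 := hM.indep_bits.indepFun_finset _ _ hST hM.measurable_bits
  have hmS : Measurable fun ω (s : (Finset.range n).disjSum (Finset.range n)) =>
      Sum.elim N W s ω := measurable_pi_lambda _ fun s => hM.measurable_bits s
  have hmT : Measurable fun ω (s : (({n} : Finset ℕ).disjSum {n} : Finset (ℕ ⊕ ℕ))) =>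
      Sum.elim N W s ω := measurable_pi_lambda _ fun s => hM.measurable_bits s
  have h2 := indepFun_prodMk_of_indepFun hM.measurable_target hmS hmT
    (hM.indep_target.comp (φ := id)
      (ψ := fun b : ℕ ⊕ ℕ → Bool =>
        ((fun s : (Finset.range n).disjSum (Finset.range n) => b s),
          fun s : (({n} : Finset ℕ).disjSum {n} : Finset (ℕ ⊕ ℕ)) => b s))
      measurable_id (by fun_prop)) h1
  have h3 := h2.comp (φ := id)
    (ψ := fun b => (b ⟨Sum.inr n, by simp⟩, b ⟨Sum.inl n, by simp⟩)) measurable_id (by fun_prop)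
  exact (IndepFun_iff_Indep _ _ _).1 h3

theorem measure_noise_eq (hM : IsSearchModel μ ε P X N W) (h0 : 0 ≤ ε) (t : ℕ) (a : Bool) :
    P (N t ⁻¹' {a}) = ENNReal.ofReal (errorProb ε a) := by
  cases a with
  | true => exact hM.law_noise t
  | false =>
    have : N t ⁻¹' {false} = (N t ⁻¹' {true})ᶜ := by ext ω; simp
    rw [this, prob_compl_eq_one_sub (hM.measurable_noise t (measurableSet_singleton _)),
      show P (N t ⁻¹' {true}) = _ from hM.law_noise t]
    simp [errorProb, ENNReal.ofReal_sub 1 h0]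

theorem measure_coin_eq (hM : IsSearchModel μ ε P X N W) (t : ℕ) (c : Bool) :
    P (W t ⁻¹' {c}) = 2⁻¹ := by
  have ht : P (W t ⁻¹' {true}) = 2⁻¹ := (hM.law_coin t).trans (by simp)
  cases c with
  | true => exact ht
  | false =>
    have : W t ⁻¹' {false} = (W t ⁻¹' {true})ᶜ := by ext ω; simp
    rw [this, prob_compl_eq_one_sub (hM.measurable_coin t (measurableSet_singleton _)), ht,
      ENNReal.one_sub_inv_two]

theorem measure_bits_eq (hM : IsSearchModel μ ε P X N W) (h0 : 0 ≤ ε) (t : ℕ) (c a : Bool) :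
    P ((fun ω => (W t ω, N t ω)) ⁻¹' {(c, a)}) = 2⁻¹ * ENNReal.ofReal (errorProb ε a) := by
  have hi : IndepFun (W t) (N t) P := hM.indep_bits.indepFun (i := Sum.inr t) (j := Sum.inl t)
    (by simp)
  rw [← hM.measure_coin_eq t c, ← hM.measure_noise_eq h0 t a,
    ← hi.measure_inter_preimage_eq_mul _ _ (measurableSet_singleton c) (measurableSet_singleton a)]
  congr 1
  ext ω
  simp

end IsSearchModel

/-! ### Change of measure -/

/-- The likelihood ratio of `n` uniform responses to the first `n` responses. -/
noncomputable def noiseRatio (ε : ℝ) {Ω : Type*} (N : ℕ → Ω → Bool) (n : ℕ) (ω : Ω) : ENNReal :=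
  ∏ t ∈ Finset.range n, (2 * ENNReal.ofReal (errorProb ε (N t ω)))⁻¹

theorem measurable_noiseRatio (ε : ℝ) {Ω : Type*} [MeasurableSpace Ω] {N : ℕ → Ω → Bool} {n : ℕ}
    (hN : ∀ t < n, Measurable (N t)) : Measurable (noiseRatio ε N n) :=
  Finset.measurable_fun_prod _ fun t ht =>
    (Measurable.of_discrete (f := fun a => (2 * ENNReal.ofReal (errorProb ε a))⁻¹)).comp
      (hN t (Finset.mem_range.1 ht))

namespace IsSearchModel

variable {d : ℕ} {μ : Measure (Space d)} {ε : ℝ} {Ω : Type*} [MeasurableSpace Ω] {P : Measure Ω}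
  [IsProbabilityMeasure P] {X : Ω → Space d} {N W : ℕ → Ω → Bool}

/-- Averaging over one more query with the uniform response law. -/
theorem lintegral_history_succ_le (hM : IsSearchModel μ ε P X N W) (h0 : 0 ≤ ε)
    {region : QueryRule d} (hr : ∀ h c, MeasurableSet (region h c)) (n : ℕ)
    {φ : History → Space d → ENNReal} (hφ : ∀ h, Measurable (φ h)) :
    ∫⁻ ω, φ (history region X N W (n + 1) ω) (X ω) * noiseRatio ε N (n + 1) ω ∂P ≤
      ∫⁻ ω, (∑ c : Bool, ∑ y : Bool, 4⁻¹ * φ ((c, y) :: history region X N W n ω) (X ω)) *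
        noiseRatio ε N n ω ∂P := by
  classical
  -- With the fresh coin and error frozen at `b`, what remains depends on the past alone.
  let F : Bool × Bool → History → Space d → ENNReal := fun b h x =>
    φ ((b.1, xor (decide (x ∈ region h b.1)) b.2) :: h) x
  have hF : ∀ b h, Measurable (F b h) := fun b h =>
    measurable_comp_of_countable (F := fun y x => φ ((b.1, y) :: h) x)
      (fun y => measurable_answer (hr h b.1) b.2 (measurableSet_singleton y)) measurable_id
      fun y => hφ _
  let G : Bool × Bool → Ω → ENNReal := fun b ω =>
    F b (history region X N W n ω) (X ω) * noiseRatio ε N n ω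
  have hG : ∀ b, Measurable[past X N W n] (G b) := by
    intro b
    let _ : MeasurableSpace Ω := past X N W n
    exact (measurable_comp_of_countable
      (measurableSet_history_eq hr (measurable_target_past n)
        (fun t ht => measurable_noise_past ht) (fun t ht => measurable_coin_past ht))
      (measurable_target_past n) (hF b)).mul
        (measurable_noiseRatio ε fun t ht => measurable_noise_past ht)
  have hG' : ∀ b, Measurable (G b) := fun b => (hG b).mono (hM.past_le n) le_rfl
  let B : Ω → Bool × Bool := fun ω => (W n ω, N n ω)
  have hB : Measurable B := (hM.measurable_coin n).prodMk (hM.measurable_noise n)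
  -- The new factor of `noiseRatio`, restricted to the event that the fresh bits equal `b`.
  let J : Bool × Bool → Ω → ENNReal := fun b =>
    (B ⁻¹' {b}).indicator fun _ => (2 * ENNReal.ofReal (errorProb ε b.2))⁻¹
  have hJ : ∀ b, Measurable[MeasurableSpace.comap B inferInstance] (J b) := fun b => by
    refine Measurable.indicator measurable_const ?_
    exact ⟨{b}, measurableSet_singleton b, rfl⟩
  have hsplit : ∀ ω, φ (history region X N W (n + 1) ω) (X ω) * noiseRatio ε N (n + 1) ω =
      ∑ b, G b ω * J b ω := by
    intro ω
    rw [Finset.sum_eq_single (B ω)]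
    · simp only [J, G, F, B, Set.indicator, Set.mem_preimage, Set.mem_singleton_iff, if_true]
      rw [noiseRatio, Finset.prod_range_succ, ← noiseRatio, mul_assoc]
      congr!
    · intro b _ hb
      simp [J, hb.symm]
    · simp
  -- The event has probability `e / 2`, which cancels `1 / (2 e)` down to `1 / 4`. If `e = 0`, then
  -- `⊤ * 0 = 0` and only `≤` survives.
  have hfac : ∀ b, ∫⁻ ω, G b ω * J b ω ∂P ≤ 4⁻¹ * ∫⁻ ω, G b ω ∂P := by
    intro b
    rw [lintegral_mul_eq_lintegral_mul_lintegral_of_independent_measurableSpace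
      (hM.past_le n) hB.comap_le (hM.indep_past_bits n) (hG b) (hJ b), mul_comm]
    gcongr
    rw [lintegral_indicator_const (hB (measurableSet_singleton b)), hM.measure_bits_eq h0]
    set e := ENNReal.ofReal (errorProb ε b.2)
    rw [ENNReal.mul_inv (Or.inl (by simp)) (Or.inl (by simp))]
    calc 2⁻¹ * e⁻¹ * (2⁻¹ * e) = 2⁻¹ * 2⁻¹ * (e⁻¹ * e) := by ring
      _ ≤ 2⁻¹ * 2⁻¹ * 1 := by gcongr; exact ENNReal.inv_mul_le_one _
      _ = 4⁻¹ := by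
        rw [mul_one, ← ENNReal.mul_inv (by simp) (by simp)]; norm_num
  simp_rw [hsplit]
  rw [lintegral_finsetSum (f := fun b ω => G b ω * J b ω) _ fun b _ =>
    (hG' b).mul ((hJ b).mono hB.comap_le le_rfl)]
  calc ∑ b, ∫⁻ ω, G b ω * J b ω ∂P ≤ ∑ b, 4⁻¹ * ∫⁻ ω, G b ω ∂P :=
        Finset.sum_le_sum fun b _ => hfac b
    _ = ∫⁻ ω, ∑ b, 4⁻¹ * G b ω ∂P := by
        rw [lintegral_finsetSum (f := fun b ω => 4⁻¹ * G b ω) _ fun b _ => (hG' b).const_mul _]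
        simp_rw [lintegral_const_mul _ (hG' _)]
    _ = _ := by
        refine lintegral_congr fun ω => ?_
        rw [Finset.sum_mul, Fintype.sum_prod_type]
        refine Finset.sum_congr rfl fun c _ => ?_
        -- For a fixed target and region, the error bit determines the response bijectively, so
        -- summing over errors is summing over responses.
        by_cases hx : X ω ∈ region (history region X N W n ω) c
        · simp [G, F, hx]; ring
        · simp [G, F, hx]; ring

/-- If `φ h` is a density for every `h`, the ratio of the densities of
`(uniform history, φ)` and `(history, target)` has expectation at most one. -/
theorem lintegral_density_ratio_le_one (hM : IsSearchModel μ ε P X N W) (hμ : IsPrior μ)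
    (h0 : 0 ≤ ε)
    {region : QueryRule d} (hr : ∀ h c, MeasurableSet (region h c)) (n : ℕ)
    {φ : History → Space d → ENNReal} (hφ : ∀ h, Measurable (φ h))
    (hφ1 : ∀ h, ∫⁻ x, φ h x ≤ 1) :
    ∫⁻ ω, φ (history region X N W n ω) (X ω) * (μ.rnDeriv volume (X ω))⁻¹ *
      noiseRatio ε N n ω ∂P ≤ 1 := by
  have hp : Measurable (μ.rnDeriv volume) := Measure.measurable_rnDeriv _ _
  induction n generalizing φ with
  | zero =>
    have := hμ.prob
    simp only [history, noiseRatio, Finset.range_zero, Finset.prod_empty, mul_one]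
    have hm : Measurable fun x => φ [] x * (μ.rnDeriv volume x)⁻¹ := (hφ []).mul hp.inv
    rw [← lintegral_map (f := fun x => φ [] x * (μ.rnDeriv volume x)⁻¹) hm hM.measurable_target,
      hM.law_target, ← lintegral_rnDeriv_mul hμ.ac hm.aemeasurable]
    -- Mass of `φ []` where the prior density vanishes is lost, hence an inequality.
    refine (lintegral_mono fun x => ?_).trans (hφ1 [])
    calc _ = φ [] x * (μ.rnDeriv volume x * (μ.rnDeriv volume x)⁻¹) := by ring
      _ ≤ φ [] x * 1 := by gcongr; exact ENNReal.mul_inv_le_one _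
      _ = φ [] x := mul_one _
  | succ n ih =>
    refine (hM.lintegral_history_succ_le h0 hr n
      (φ := fun h x => φ h x * (μ.rnDeriv volume x)⁻¹) fun h => (hφ h).mul hp.inv).trans ?_
    refine le_of_eq_of_le (lintegral_congr fun ω => ?_)
      -- The average of `φ` over the four one-step extensions of `h` again has total mass at most
      -- one.
      (ih (φ := fun h x => ∑ c : Bool, ∑ y : Bool, 4⁻¹ * φ ((c, y) :: h) x)
        (fun h => by fun_prop) fun h => ?_)
    · simp only [Finset.sum_mul, mul_assoc]
    · simp_rw [Fintype.sum_bool]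
      rw [lintegral_add_left (by fun_prop), lintegral_add_left (by fun_prop),
        lintegral_add_left (by fun_prop)]
      simp_rw [lintegral_const_mul _ (hφ _)]
      calc _ ≤ (4⁻¹ * 1 + 4⁻¹ * 1 + (4⁻¹ * 1 + 4⁻¹ * 1) : ENNReal) := by
            gcongr <;> exact hφ1 _
        _ = 4 * 4⁻¹ := by ring
        _ = 1 := ENNReal.mul_inv_cancel (by simp) (by simp)

end IsSearchModel

/-! ### The Gaussian reference density -/

/-- Density of the centred Gaussian with covariance `s` times the identity. -/
noncomputable def gaussianDensity {d : ℕ} (s : ℝ) (z : Space d) : ℝ :=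
  Real.exp (-((d : ℝ) / 2 * Real.log (2 * Real.pi * s)) - ‖z‖ ^ 2 / (2 * s))

theorem gaussianDensity_pos {d : ℕ} (s : ℝ) (z : Space d) : 0 < gaussianDensity s z :=
  Real.exp_pos _

theorem continuous_gaussianDensity {d : ℕ} (s : ℝ) :
    Continuous (gaussianDensity s : Space d → ℝ) := by
  unfold gaussianDensity; fun_prop

theorem lintegral_gaussianDensity {d : ℕ} {s : ℝ} (hs : 0 < s) (m : Space d) :
    ∫⁻ x, ENNReal.ofReal (gaussianDensity s (x - m)) = 1 := by
  rw [lintegral_sub_right_eq_self (fun x => ENNReal.ofReal (gaussianDensity s x)) m]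
  have hI : ∫ x : Space d, gaussianDensity s x = 1 := by
    have hg : (gaussianDensity s : Space d → ℝ) = fun x =>
        Real.exp (-((d : ℝ) / 2 * Real.log (2 * Real.pi * s))) *
          Real.exp (-(1 / (2 * s)) * ‖x‖ ^ 2) := by
      ext x; rw [gaussianDensity, ← Real.exp_add]; congr 1; ring
    have hpos : 0 < 2 * Real.pi * s := by positivity
    rw [hg, integral_const_mul, GaussianFourier.integral_rexp_neg_mul_sq_norm (by positivity),
      finrank_euclideanSpace_fin, show Real.pi / (1 / (2 * s)) = 2 * Real.pi * s by field_simp,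
      Real.rpow_def_of_pos hpos, ← Real.exp_add]
    simp [mul_comm]
  rw [← ofReal_integral_eq_lintegral_ofReal
    -- Integrability comes for free: a non-integrable function would have integral 0, not 1.
    (by by_contra h; rw [integral_undef h] at hI; exact zero_ne_one hI)
    (Filter.Eventually.of_forall fun x => (gaussianDensity_pos s x).le), hI, ENNReal.ofReal_one]

/-! ### Expectations of logarithms -/

theorem IsPrior.integrable_log_density {d : ℕ} {μ : Measure (Space d)} (hμ : IsPrior μ) :
    Integrable (fun x => Real.log (density μ x)) μ := by
  have := hμ.prob
  rw [← integrable_rnDeriv_smul_iff hμ.ac]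
  simpa [Real.negMulLog, density] using hμ.finite_entropy.neg

theorem IsPrior.integral_log_density {d : ℕ} {μ : Measure (Space d)} (hμ : IsPrior μ) :
    ∫ x, Real.log (density μ x) ∂μ = -differentialEntropy μ := by
  have := hμ.prob
  rw [← integral_rnDeriv_smul hμ.ac, differentialEntropy, ← integral_neg]
  simp [Real.negMulLog, density]

namespace IsSearchModel

variable {d : ℕ} {μ : Measure (Space d)} {ε : ℝ} {Ω : Type*} [MeasurableSpace Ω] {P : Measure Ω}
  {X : Ω → Space d} {N W : ℕ → Ω → Bool}

/-- Almost surely no logarithm of zero occurs: if `ε = 0`, errors form a null event. -/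
theorem ae_errorProb_pos (hM : IsSearchModel μ ε P X N W) (h0 : 0 ≤ ε) (h1 : ε < 1) (t : ℕ) :
    ∀ᵐ ω ∂P, 0 < errorProb ε (N t ω) := by
  rcases h0.eq_or_lt with rfl | h0
  · have : P {ω | N t ω = true} = 0 := by simpa using hM.law_noise t
    rw [measure_eq_zero_iff_ae_notMem] at this
    filter_upwards [this] with ω hω
    have : N t ω = false := by simpa using hω
    simp [errorProb, this]
  · refine Filter.Eventually.of_forall fun ω => ?_
    unfold errorProb; split_ifs <;> linarith

variable [IsProbabilityMeasure P]

theorem integrable_bit (hM : IsSearchModel μ ε P X N W) (t : ℕ) (f : Bool → ℝ) :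
    Integrable (fun ω => f (N t ω)) P := by
  refine Integrable.of_bound (C := max |f true| |f false|)
    ((Measurable.of_discrete (f := f)).comp (hM.measurable_noise t)).aestronglyMeasurable
    (Filter.Eventually.of_forall fun ω => ?_)
  cases N t ω <;> simp

theorem integral_bit (hM : IsSearchModel μ ε P X N W) (h0 : 0 ≤ ε) (h1 : ε ≤ 1) (t : ℕ)
    (f : Bool → ℝ) : ∫ ω, f (N t ω) ∂P = ε * f true + (1 - ε) * f false := by
  rw [← integral_map (f := f) (hM.measurable_noise t).aemeasurable
    (Measurable.of_discrete).aestronglyMeasurable]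
  have := Measure.isProbabilityMeasure_map (μ := P) (hM.measurable_noise t).aemeasurable
  rw [integral_fintype (Integrable.of_finite)]
  have hm : ∀ a, (P.map (N t)).real {a} = errorProb ε a := fun a => by
    rw [Measure.real, Measure.map_apply (hM.measurable_noise t) (measurableSet_singleton a),
      hM.measure_noise_eq h0, ENNReal.toReal_ofReal]
    cases a <;> simp [errorProb, h0, h1]
  simp [hm, errorProb]

/-- The entropy balance of the search, tested against a Gaussian centred at the estimate. -/
theorem differentialEntropy_le (hM : IsSearchModel μ ε P X N W) (hμ : IsPrior μ)
    (h0 : 0 ≤ ε) (h1 : ε < 1) {region : QueryRule d} (hr : ∀ h c, MeasurableSet (region h c))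
    (n : ℕ) (est : History → Space d) {s : ℝ} (hs : 0 < s)
    (hI : Integrable (fun ω => ‖est (history region X N W n ω) - X ω‖ ^ 2) P) :
    differentialEntropy μ ≤ n * bscCapacity ε + d / 2 * Real.log (2 * Real.pi * s) +
      (∫ ω, ‖est (history region X N W n ω) - X ω‖ ^ 2 ∂P) / (2 * s) := by
  set H := history region X N W n
  let R : Ω → ENNReal := fun ω => ENNReal.ofReal (gaussianDensity s (X ω - est (H ω))) *
    (μ.rnDeriv volume (X ω))⁻¹ * noiseRatio ε N n ω
  have hp : Measurable (μ.rnDeriv volume) := Measure.measurable_rnDeriv _ _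
  have hgm : ∀ h, Measurable fun x : Space d =>
      ENNReal.ofReal (gaussianDensity s (x - est h)) := fun h =>
    ((continuous_gaussianDensity s).measurable.comp
      (measurable_id.sub measurable_const)).ennreal_ofReal
  have hR1 : ∫⁻ ω, R ω ∂P ≤ 1 := hM.lintegral_density_ratio_le_one hμ h0 hr n
    (φ := fun h x => ENNReal.ofReal (gaussianDensity s (x - est h))) hgm
    fun h => (lintegral_gaussianDensity hs _).le
  have hRm : Measurable R := by
    refine Measurable.mul (Measurable.mul ?_ (hp.comp hM.measurable_target).inv)
      (measurable_noiseRatio ε fun t _ => hM.measurable_noise t)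
    exact measurable_comp_of_countable
      (measurableSet_history_eq hr hM.measurable_target (fun t _ => hM.measurable_noise t)
        fun t _ => hM.measurable_coin t) hM.measurable_target hgm
  have hRi : Integrable (fun ω => (R ω).toReal) P :=
    integrable_toReal_of_lintegral_ne_top hRm.aemeasurable (hR1.trans_lt ENNReal.one_lt_top).ne
  have hRint : ∫ ω, (R ω).toReal ∂P ≤ 1 := by
    rw [integral_toReal hRm.aemeasurable
      (ae_lt_top hRm (hR1.trans_lt ENNReal.one_lt_top).ne)]
    exact ENNReal.toReal_le_of_le_ofReal zero_le_one (by simpa using hR1)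
  have hpX : ∀ᵐ ω ∂P, 0 < density μ (X ω) := by
    have := hμ.prob
    have h := (Measure.rnDeriv_pos hμ.ac).and (hμ.ac.ae_le (Measure.rnDeriv_lt_top μ volume))
    rw [← hM.law_target] at h
    filter_upwards [ae_of_ae_map hM.measurable_target.aemeasurable h] with ω hω
    rw [hM.law_target] at hω
    exact ENNReal.toReal_pos hω.1.ne' hω.2.ne
  -- This is `log R ≤ R - 1`, with `log R` written as a sum of separately integrable terms.
  have hlog : ∀ᵐ ω ∂P, -((d : ℝ) / 2 * Real.log (2 * Real.pi * s)) -
      ‖est (H ω) - X ω‖ ^ 2 / (2 * s) - Real.log (density μ (X ω)) -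
      ∑ t ∈ Finset.range n, (Real.log 2 + Real.log (errorProb ε (N t ω))) ≤
        (R ω).toReal - 1 := by
    filter_upwards [hpX, ae_all_iff.2 (hM.ae_errorProb_pos h0 h1)] with ω hω hN
    have hnoise : (noiseRatio ε N n ω).toReal =
        ∏ t ∈ Finset.range n, (2 * errorProb ε (N t ω))⁻¹ := by
      rw [noiseRatio, ENNReal.toReal_prod]
      simp [ENNReal.toReal_ofReal (hN _).le]
    have hRr : (R ω).toReal = gaussianDensity s (X ω - est (H ω)) * (density μ (X ω))⁻¹ *
        ∏ t ∈ Finset.range n, (2 * errorProb ε (N t ω))⁻¹ := by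
      simp only [R]
      rw [ENNReal.toReal_mul, ENNReal.toReal_mul, hnoise, ENNReal.toReal_inv,
        ENNReal.toReal_ofReal (gaussianDensity_pos _ _).le, density]
    have hprod : 0 < ∏ t ∈ Finset.range n, (2 * errorProb ε (N t ω))⁻¹ :=
      Finset.prod_pos fun t _ => inv_pos.2 (mul_pos two_pos (hN t))
    have hg : 0 < gaussianDensity s (X ω - est (H ω)) := gaussianDensity_pos _ _
    have hgd := mul_pos hg (inv_pos.2 hω)
    refine le_of_eq_of_le ?_ (Real.log_le_sub_one_of_pos (hRr ▸ mul_pos hgd hprod))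
    rw [hRr, Real.log_mul hgd.ne' hprod.ne', Real.log_mul hg.ne' (inv_pos.2 hω).ne',
      Real.log_inv, Real.log_prod fun t _ => (inv_pos.2 (mul_pos two_pos (hN t))).ne',
      gaussianDensity, Real.log_exp, norm_sub_rev (X ω)]
    simp_rw [Real.log_inv, Real.log_mul two_ne_zero (hN _).ne']
    rw [Finset.sum_neg_distrib]
    ring
  have hden : Integrable (fun ω => Real.log (density μ (X ω))) P := by
    have h := hμ.integrable_log_density
    rw [← hM.law_target] at h
    have h' := h.comp_measurable hM.measurable_target
    rwa [hM.law_target] at h'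
  have hdenI : ∫ ω, Real.log (density μ (X ω)) ∂P = -differentialEntropy μ := by
    rw [← hμ.integral_log_density]
    have h := hμ.integrable_log_density.aestronglyMeasurable
    conv_rhs => rw [← hM.law_target]
    rw [integral_map hM.measurable_target.aemeasurable (by rw [hM.law_target]; exact h),
      hM.law_target]
  have hbit : ∀ t ∈ Finset.range n,
      Integrable (fun ω => Real.log 2 + Real.log (errorProb ε (N t ω))) P := fun t _ =>
    hM.integrable_bit t fun a => Real.log 2 + Real.log (errorProb ε a)
  have hsum := integrable_finsetSum (Finset.range n) hbit
  have hd2 := hI.div_const (2 * s)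
  have hc : Integrable (fun _ : Ω => -((d : ℝ) / 2 * Real.log (2 * Real.pi * s))) P :=
    integrable_const _
  have hmono := integral_mono_ae (((hc.sub hd2).sub hden).sub hsum)
    (hRi.sub (integrable_const 1)) hlog
  rw [integral_sub' ((hc.sub hd2).sub hden) hsum, integral_sub' (hc.sub hd2) hden,
    integral_sub' hc hd2, integral_sub' hRi (integrable_const 1), integral_finsetSum _ hbit,
    hdenI, integral_div] at hmono
  have hb : ∀ t, ∫ ω, (Real.log 2 + Real.log (errorProb ε (N t ω))) ∂P =
      Real.log 2 + (ε * Real.log ε + (1 - ε) * Real.log (1 - ε)) := fun t => by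
    rw [hM.integral_bit h0 h1.le t fun a => Real.log 2 + Real.log (errorProb ε a)]
    simp only [errorProb, if_true, Bool.false_eq_true, if_false]
    ring
  simp only [hb, integral_const, probReal_univ, one_smul, Finset.sum_const, Finset.card_range,
    nsmul_eq_mul] at hmono
  have hcap := mul_le_mul_of_nonneg_left
    (log_two_sub_noise_entropy_le_bscCapacity h0 h1.le) n.cast_nonneg (α := ℝ)
  linarith

/-- The lower bound holds for every measurable query rule and every estimator. -/
theorem le_meanSquaredError (hM : IsSearchModel μ ε P X N W) (hμ : IsPrior μ) (hd : 0 < d)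
    {η : ℝ} (hη : d * η ≤ differentialEntropy μ) (h0 : 0 ≤ ε) (h1 : ε < 1)
    {region : QueryRule d} (hr : ∀ h c, MeasurableSet (region h c)) (n : ℕ)
    (est : History → Space d) :
    ENNReal.ofReal (Real.exp (2 * η - 1) / (2 * Real.pi) * d *
        Real.exp (-2 * n * bscCapacity ε / d)) ≤
      meanSquaredError P (fun ω => est (history region X N W n ω)) X := by
  by_cases htop : meanSquaredError P (fun ω => est (history region X N W n ω)) X = ⊤
  · rw [htop]; exact le_top
  have hm : Measurable fun ω => ‖est (history region X N W n ω) - X ω‖ ^ 2 :=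
    measurable_comp_of_countable (F := fun h x => ‖est h - x‖ ^ 2)
      (measurableSet_history_eq hr hM.measurable_target (fun t _ => hM.measurable_noise t)
        fun t _ => hM.measurable_coin t) hM.measurable_target fun h => by fun_prop
  have hnn : 0 ≤ᵐ[P] fun ω => ‖est (history region X N W n ω) - X ω‖ ^ 2 :=
    Filter.Eventually.of_forall fun ω => sq_nonneg _
  have hI : Integrable (fun ω => ‖est (history region X N W n ω) - X ω‖ ^ 2) P :=
    (lintegral_ofReal_ne_top_iff_integrable hm.aestronglyMeasurable hnn).1 htop
  rw [meanSquaredError, ← ofReal_integral_eq_lintegral_ofReal hI hnn]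
  refine ENNReal.ofReal_le_ofReal ?_
  set M := ∫ ω, ‖est (history region X N W n ω) - X ω‖ ^ 2 ∂P
  have hd' : (0 : ℝ) < d := Nat.cast_pos.2 hd
  -- With `s = exp r / (2 π)`, the terms other than `M / (2 s)` on the right of the entropy balance
  -- add up to `d η - d / 2`. This leaves `M ≥ d s`, the claim. Fixing `s` in advance, rather than
  -- optimising at `M / d`, needs no positivity of `M`.
  set r := 2 * η - 1 + -2 * n * bscCapacity ε / d with hr'
  have hs : 0 < Real.exp r / (2 * Real.pi) := by positivity
  have hkey := hη.trans (hM.differentialEntropy_le hμ h0 h1 hr n est hs hI)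
  rw [show 2 * Real.pi * (Real.exp r / (2 * Real.pi)) = Real.exp r by field_simp,
    Real.log_exp] at hkey
  have hdr : d / 2 * r = d * η - d / 2 - n * bscCapacity ε := by
    rw [hr']; field_simp; ring
  have hM2 : (d : ℝ) / 2 ≤ M / (2 * (Real.exp r / (2 * Real.pi))) := by linarith
  rw [le_div_iff₀ (by positivity)] at hM2
  calc _ = d / 2 * (2 * (Real.exp r / (2 * Real.pi))) := by
        rw [hr', Real.exp_add]; ring
    _ ≤ M := hM2

end IsSearchModel

theorem IndependentPolicy.measurableSet_region {d : ℕ} {μ : Measure (Space d)} {ε : ℝ}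
    (π : IndependentPolicy μ ε) (h : History) (c : Bool) : MeasurableSet (π.region h c) := by
  have hl : MeasurableSet (halfLine (π.point h) c) := by
    unfold halfLine; split_ifs
    · exact measurableSet_Iic
    · exact measurableSet_Ioi
  have hx : Measurable fun x : Space d => x (π.axis h.length) := by fun_prop
  exact hx hl

end TargetSearch

theorem proposition1 (η : ℝ) :
    ∃ K : ℝ, 0 < K ∧
      ∀ (d : ℕ), 0 < d →
      ∀ (μ : MeasureTheory.Measure (TargetSearch.Space d)), TargetSearch.IsPrior μ →
      d * η ≤ TargetSearch.differentialEntropy μ →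
      ∀ (ε : ℝ), 0 ≤ ε → ε < 1 / 2 →
      ∀ (Ω : Type*) [MeasurableSpace Ω] (P : MeasureTheory.Measure Ω)
        [MeasureTheory.IsProbabilityMeasure P]
        (X : Ω → TargetSearch.Space d) (N W : ℕ → Ω → Bool),
      TargetSearch.IsSearchModel μ ε P X N W →
      ∀ n : ℕ,
        (∀ (π : TargetSearch.IndependentPolicy μ ε), π.EqualAllocation n →
          ∀ est : TargetSearch.History → TargetSearch.Space d, π.IsMedianEstimate est →
            ENNReal.ofReal (K * d * Real.exp (-2 * n * TargetSearch.bscCapacity ε / d)) ≤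
              TargetSearch.meanSquaredError P
                (fun ω => est (TargetSearch.history π.region X N W n ω)) X) ∧
        (∀ (π : TargetSearch.JointPolicy d),
          ∀ est : TargetSearch.History → TargetSearch.Space d, π.IsMedianEstimate μ ε est →
            ENNReal.ofReal (K * d * Real.exp (-2 * n * TargetSearch.bscCapacity ε / d)) ≤
              TargetSearch.meanSquaredError P
                (fun ω => est (TargetSearch.history π.region X N W n ω)) X) := by
  -- The variance `exp (2 η) / (2 π e)` of a one-dimensional Gaussian with entropy `η`.
  refine ⟨Real.exp (2 * η - 1) / (2 * Real.pi), by positivity, ?_⟩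
  intro d hd μ hμ hη ε h0 h1 Ω _ P _ X N W hM n
  have h1' : ε < 1 := h1.trans (by norm_num)
  exact ⟨fun π _ est _ => hM.le_meanSquaredError hμ hd hη h0 h1' π.measurableSet_region n est,
    fun π est _ => hM.le_meanSquaredError hμ hd hη h0 h1' π.measurableSet_region n est⟩
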